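/- **Particle states.** Each particle has a 21-dimensional state space with standard basis $E_x, e_x, U_x, u_x, W, w, R_x, \hat R_x, L, \uparrow, \hat\uparrow, \downarrow_x, \langle, \rangle$, where $x\in\{0,1\}$ is a qubit value. The transition rules $ab\to cd$ on two neighbouring particles are, for all $x,y\in\{0,1\}$: $R_xU_y\to u_yR_x$; $R_xW\to wR_x$; $R_xE_y\to\downarrow_xE_y$; $w\downarrow_x\to LE_x$; $wL\to LW$; $u_yL\to LU_y$; $e_yL\to e_y\uparrow$; $\uparrow U_x\to e_xR_x$; $\hat\uparrow U_x\to e_x\hat R_x$; $\hat R_xU_y\to u_y\hat R_x$; $\hat R_xW\to w\hat R_x$; $\hat R_x\rangle\to\downarrow_x\rangle$. **Ground state of a segment.** Let $n=2m+3\ge 3$ be odd. For $x\in\{0,1\}^m$ let $P_x$ be the set of standard basis states of a chain of $n$ particles that can be reached from $\langle\,\hat\uparrow\,U_{x_1}\cdots U_{x_m}\,W^m\,\rangle$ by applying transition rules in the forward direction, let $|\phi_x\rangle=|P_x|^{-1/2}\sum_{s\in P_x}|s\rangle$, and let $|\phi_g\rangle=2^{-m/2}\sum_{x\in\{0,1\}^m}|\phi_x\rangle$.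 **States on the cycle.** Let $t\ge2$ and consider a cycle of $nt$ particles. For $0\le i\le n-1$ cut the cycle into $t$ segments of $n$ consecutive particles, the first one starting at site $i$, and let $|\psi_i\rangle$ be the tensor product of $t$ copies of $|\phi_g\rangle$, one on each segment. **Good particles.** Let $A$ be a set of particles on the cycle. A particle in $A$ is *good* for $|\psi_i\rangle$ if it is the $p$-th particle ($1\le p\le n$) of some segment, where $2\le p\le n/4$ or $3n/4\le p\le n-1$, and the $(n+1-p)$-th particle of the same segment (its entangled partner) is not in $A$. **Lemma.** Let $A$ be a contiguous set of $r\le nt-n$ particles on the cycle, let $0\le i\le n-1$, and let $\rho_i^A$ be the reduced state of $|\psi_i\rangle\langle\psi_i|$ on $A$. Then the von Neumann entropy $S(\rho_i^A)=-\operatorname{tr}(\rho_i^A\log_2\rho_i^A)$ satisfies $$S(\rho_i^A)\ \ge\ \tfrac14\,\bigl|\{\text{particles in }A\text{ that are good for }|\psi_i\rangle\}\bigr| .$$ -/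

import Mathlib

/-- The 21 standard basis states of one particle.  A `Bool` argument is the value of the qubit
stored in a two-state subsystem. -/
inductive SiteState : Type
  /-- upper case `E`: entangled qubit, to the right of the control site -/
  | upE (x : Bool)
  /-- lower case `e`: entangled qubit, to the left of the control site -/
  | loE (x : Bool)
  /-- upper case `U`: unentangled qubit, to the right of the control site -/
  | upU (x : Bool)
  /-- lower case `u`: unentangled qubit, to the left of the control site -/
  | loU (x : Bool)
  /-- upper case `W`: waiting particle, to the right of the control site -/
  | upW
  /-- lower case `w`: waiting particle, to the left of the control site -/
  | loW
  /-- single right-moving control state -/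
  | right (x : Bool)
  /-- double right-moving control state -/
  | dright (x : Bool)
  /-- left-moving control state -/
  | left
  /-- single left-end turning control state -/
  | turnUp
  /-- double left-end turning control state -/
  | dturnUp
  /-- right-end turning control state -/
  | turnDown (x : Bool)
  /-- left delimiter -/
  | leftEnd
  /-- right delimiter -/
  | rightEnd
  deriving DecidableEq, Fintype

/-- `TransitionRule a b c d` is the rule `a b → c d` on two neighbouring particles. -/
inductive TransitionRule : SiteState → SiteState → SiteState → SiteState → Prop
  | right_U (x y : Bool) : TransitionRule (.right x) (.upU y) (.loU y) (.right x)
  | right_W (x : Bool) : TransitionRule (.right x) .upW .loW (.right x)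
  | right_E (x y : Bool) : TransitionRule (.right x) (.upE y) (.turnDown x) (.upE y)
  | w_turnDown (x : Bool) : TransitionRule .loW (.turnDown x) .left (.upE x)
  | w_left : TransitionRule .loW .left .left .upW
  | u_left (y : Bool) : TransitionRule (.loU y) .left .left (.upU y)
  | e_left (y : Bool) : TransitionRule (.loE y) .left (.loE y) .turnUp
  | turnUp_U (x : Bool) : TransitionRule .turnUp (.upU x) (.loE x) (.right x)
  | dturnUp_U (x : Bool) : TransitionRule .dturnUp (.upU x) (.loE x) (.dright x)
  | dright_U (x y : Bool) : TransitionRule (.dright x) (.upU y) (.loU y) (.dright x)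
  | dright_W (x : Bool) : TransitionRule (.dright x) .upW .loW (.dright x)
  | dright_end (x : Bool) : TransitionRule (.dright x) .rightEnd (.turnDown x) .rightEnd

/-- Directed edges of the state graph of the finite chain with `n` particles: `s'` arises from the
standard basis state `s` by one application of a transition rule to two neighbouring particles. -/
def ChainStep (n : ℕ) (s s' : Fin n → SiteState) : Prop :=
  ∃ k l : Fin n, (l : ℕ) = (k : ℕ) + 1 ∧ TransitionRule (s k) (s l) (s' k) (s' l) ∧
    ∀ q : Fin n, q ≠ k → q ≠ l → s' q = s q

/-- For `n = 2 m + 3`: the start state consisting of the left delimiter, the double left-end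
turning control state, `m` sites `U` carrying the qubit values `x`, `m` sites `W`, and the right
delimiter. -/
def startState (n : ℕ) (x : Fin ((n - 3) / 2) → Bool) : Fin n → SiteState := fun k =>
  if (k : ℕ) = 0 then .leftEnd
  else if (k : ℕ) = 1 then .dturnUp
  else if h : (k : ℕ) - 2 < (n - 3) / 2 then .upU (x ⟨(k : ℕ) - 2, h⟩)
  else if (k : ℕ) < 2 + 2 * ((n - 3) / 2) then .upW
  else .rightEnd

/-- The standard basis states on the path of the state graph that begins with the start state. -/
def startPath (n : ℕ) (x : Fin ((n - 3) / 2) → Bool) : Set (Fin n → SiteState) :=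
  {s | Relation.ReflTransGen (ChainStep n) (startState n x) s}

open Classical in
/-- `|φ_x⟩`, the uniform superposition of the states on the path that begins with the start state,
given by its amplitudes in the standard basis. -/
noncomputable def phiPath (n : ℕ) (x : Fin ((n - 3) / 2) → Bool) (s : Fin n → SiteState) : ℂ :=
  if s ∈ startPath n x then (((Real.sqrt ((startPath n x).ncard : ℝ))⁻¹ : ℝ) : ℂ) else 0

/-- `|φ_g⟩ = 2^{-m/2} ∑_x |φ_x⟩`, the ground state of the finite chain. -/
noncomputable def phiGround (n : ℕ) (s : Fin n → SiteState) : ℂ :=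
  (((Real.sqrt (2 ^ ((n - 3) / 2) : ℝ))⁻¹ : ℝ) : ℂ) *
    ∑ x : Fin ((n - 3) / 2) → Bool, phiPath n x s

/-- On the cycle with `n t` particles cut into `t` segments of length `n`, the first of which starts
at site `i`: the site of the `p`-th particle (`1 ≤ p ≤ n`) of the `j`-th segment (`0 ≤ j < t`). -/
def segmentSite (n t : ℕ) [NeZero (n * t)] (i : Fin n) (j p : ℕ) : Fin (n * t) :=
  Fin.ofNat (n * t) ((i : ℕ) + j * n + (p - 1))

/-- `|ψ_i⟩`, the tensor product of `t` copies of `|φ_g⟩` placed on the `t` segments of length `n` of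
the cycle, rotated by `i` positions. -/
noncomputable def psiCycle (n t : ℕ) [NeZero (n * t)] (i : Fin n)
    (s : Fin (n * t) → SiteState) : ℂ :=
  ∏ j : Fin t, phiGround n (fun q : Fin n => s (segmentSite n t i j ((q : ℕ) + 1)))

/-- The contiguous set of the particles `a, a + 1, …, a + r - 1` on the cycle with `N` sites. -/
def arc {N : ℕ} [NeZero N] (a : Fin N) (r : ℕ) : Finset (Fin N) :=
  (Finset.range r).image (fun k => Fin.ofNat N ((a : ℕ) + k))

open Classical in
/-- The particles in `A` that are good for `|ψ_i⟩`: those that are the `p`-th particle of a segment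
with `2 ≤ p ≤ n/4` or `3n/4 ≤ p ≤ n - 1` and whose partner, the `(n + 1 - p)`-th particle of the
same segment, is not in `A`. -/
noncomputable def goodParticles (n t : ℕ) [NeZero (n * t)] (i : Fin n)
    (A : Finset (Fin (n * t))) : Finset (Fin (n * t)) :=
  A.filter (fun k => ∃ j p : ℕ, j < t ∧ k = segmentSite n t i j p ∧
    ((2 ≤ p ∧ (p : ℝ) ≤ (n : ℝ) / 4) ∨ (3 * (n : ℝ) / 4 ≤ (p : ℝ) ∧ p + 1 ≤ n)) ∧
    segmentSite n t i j (n + 1 - p) ∉ A)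

/-- The basis state that agrees with `a` on the particles in `A` and with `b` on the others. -/
def glue {S Q : Type*} [DecidableEq S] (A : Finset S) (a : {k // k ∈ A} → Q)
    (b : {k // k ∉ A} → Q) : S → Q :=
  fun k => if h : k ∈ A then a ⟨k, h⟩ else b ⟨k, h⟩

/-- The reduced density matrix on `A` of the pure state with amplitudes `ψ`: the partial trace of
`|ψ⟩⟨ψ|` over the particles outside `A`, in the standard basis. -/
noncomputable def reducedDensity {S Q : Type*} [Fintype S] [DecidableEq S] [Fintype Q]
    (ψ : (S → Q) → ℂ) (A : Finset S) :
    Matrix ({k // k ∈ A} → Q) ({k // k ∈ A} → Q) ℂ :=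
  Matrix.of fun a a' => ∑ b : {k // k ∉ A} → Q, ψ (glue A a b) * star (ψ (glue A a' b))

theorem reducedDensity_isHermitian {S Q : Type*} [Fintype S] [DecidableEq S] [Fintype Q]
    (ψ : (S → Q) → ℂ) (A : Finset S) : (reducedDensity ψ A).IsHermitian := by
  ext a a'
  simp [reducedDensity, Matrix.conjTranspose_apply, mul_comm]

/-- The von Neumann entropy `- tr (ρ log₂ ρ)`, in bits, through the eigenvalues of `ρ`. -/
noncomputable def vonNeumannEntropy {ι : Type*} [Fintype ι] [DecidableEq ι]
    (ρ : Matrix ι ι ℂ) (hρ : ρ.IsHermitian) : ℝ :=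
  ∑ k : ι, - (hρ.eigenvalues k * Real.logb 2 (hρ.eigenvalues k))

/-- The entropy of the state with amplitudes `ψ` traced down to the particles in `A`. -/
noncomputable def entanglementEntropy {S Q : Type*} [Fintype S] [DecidableEq S] [Fintype Q]
    [DecidableEq Q] (ψ : (S → Q) → ℂ) (A : Finset S) : ℝ :=
  vonNeumannEntropy (reducedDensity ψ A) (reducedDensity_isHermitian ψ A)

/-- A density matrix `∑ b, |V b⟩⟨V b|` whose summands are grouped into classes, such that in each
class `c` the summands carry labels that are also determined by the basis state and no label has more
than the fraction `2 ^ (-q c)` of the weight of the class, has entropy at least the mean of `q`. -/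
theorem le_vonNeumannEntropy_of_labels {α β C Z : Type*} [Fintype α] [DecidableEq α] [Fintype β]
    [Fintype C] [DecidableEq C] [DecidableEq Z] (V : β → α → ℂ) (ρ : Matrix α α ℂ)
    (hρ : ρ.IsHermitian) (hV : ∀ a a', ρ a a' = ∑ b, V b a * star (V b a'))
    (cls : β → C) (f : C → α → Z) (g : β → Z) (p q : C → ℝ)
    (hsupp : ∀ b a, V b a ≠ 0 → f (cls b) a = g b)
    (hp : ∀ c, ∑ b with cls b = c, ∑ a, ‖V b a‖ ^ 2 = p c) (hp1 : ∑ c, p c = 1)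
    (hle : ∀ c z, ∑ b with cls b = c ∧ g b = z, ∑ a, ‖V b a‖ ^ 2 ≤ p c * 2 ^ (-q c)) :
    ∑ c, p c * q c ≤ vonNeumannEntropy ρ hρ := by
  set u := hρ.eigenvectorBasis with hu
  set amp : α → β → ℂ := fun k b => ∑ a, star (u k a) * V b a with hamp
  set w : C → α → ℝ := fun c k => ∑ b with cls b = c, ‖amp k b‖ ^ 2 with hw
  have hw0 : ∀ c k, 0 ≤ w c k := fun c k => Finset.sum_nonneg fun b _ => by positivity
  have hp0 : ∀ c, 0 ≤ p c := fun c => by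
    rw [← hp]; exact Finset.sum_nonneg fun b _ => Finset.sum_nonneg fun a _ => by positivity
  have hunit : ∀ k, ∑ a, ‖u k a‖ ^ 2 = 1 := fun k => by
    rw [← EuclideanSpace.norm_sq_eq, u.orthonormal.1 k, one_pow]
  have heig : ∀ k, hρ.eigenvalues k = ∑ c, w c k := fun k => by
    have h1 : ∑ c, w c k = ∑ b, ‖amp k b‖ ^ 2 := by
      simp only [hw]
      exact Finset.sum_fiberwise _ _ _
    have h2 : ((∑ b, ‖amp k b‖ ^ 2 : ℝ) : ℂ) = star (⇑(u k)) ⬝ᵥ ρ.mulVec ⇑(u k) := by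
      simp only [dotProduct, Matrix.mulVec, hV, Pi.star_apply, Complex.ofReal_sum,
        Complex.ofReal_pow, ← Complex.conj_mul', hamp, map_sum, Finset.sum_mul, Finset.mul_sum]
      rw [Finset.sum_comm]
      refine Finset.sum_congr rfl fun a _ => ?_
      rw [Finset.sum_comm]
      refine Finset.sum_congr rfl fun a' _ => Finset.sum_congr rfl fun b _ => ?_
      simp only [map_mul, RCLike.star_def, Complex.conj_conj]
      ring
    rw [hρ.eigenvalues_eq, h1]
    have := congrArg Complex.re h2
    rw [Complex.ofReal_re] at this
    rw [this]; rfl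
  have hsumw : ∀ c, ∑ k, w c k = p c := fun c => by
    rw [← hp, hw, Finset.sum_comm]
    refine Finset.sum_congr rfl fun b _ => ?_
    have h := u.sum_sq_norm_inner_right (WithLp.toLp 2 (V b))
    rw [EuclideanSpace.norm_sq_eq] at h
    rw [← h]
    refine Finset.sum_congr rfl fun k _ => ?_
    simp only [hamp, PiLp.inner_apply, RCLike.inner_apply, RCLike.star_def, mul_comm]
  have hwle : ∀ c k, w c k ≤ p c * 2 ^ (-q c) := fun c k => by
    calc w c k ≤ ∑ b with cls b = c, ∑ a, if f c a = g b then ‖u k a‖ ^ 2 * ∑ a', ‖V b a'‖ ^ 2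
            else 0 := by
          refine Finset.sum_le_sum fun b hb => ?_
          have hb : cls b = c := (Finset.mem_filter.1 hb).2
          rw [← Finset.sum_filter, ← Finset.sum_mul]
          have h1 : amp k b = ∑ a with f c a = g b, star (u k a) * V b a := by
            rw [Finset.sum_filter]
            refine Finset.sum_congr rfl fun a _ => ?_
            split_ifs with h
            · rfl
            · have : V b a = 0 := by
                by_contra h0
                exact h (hb ▸ hsupp b a h0)
              simp [this]
          calc ‖amp k b‖ ^ 2 ≤ (∑ a with f c a = g b, ‖u k a‖ * ‖V b a‖) ^ 2 := by
                rw [h1]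
                gcongr
                refine (norm_sum_le _ _).trans (Finset.sum_le_sum fun a _ => ?_)
                simp
            _ ≤ _ := Finset.sum_mul_sq_le_sq_mul_sq _ _ _
            _ ≤ _ := by
                refine mul_le_mul_of_nonneg_left (Finset.sum_le_sum_of_subset_of_nonneg
                  (Finset.filter_subset _ _) fun a _ _ => by positivity)
                  (Finset.sum_nonneg fun a _ => by positivity)
      _ = ∑ a, ‖u k a‖ ^ 2 * ∑ b with cls b = c ∧ g b = f c a, ∑ a', ‖V b a'‖ ^ 2 := by
          rw [Finset.sum_comm]
          refine Finset.sum_congr rfl fun a _ => ?_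
          rw [← Finset.filter_filter, Finset.sum_filter (fun b => g b = f c a), Finset.mul_sum]
          refine Finset.sum_congr rfl fun b _ => ?_
          simp only [eq_comm, mul_ite, mul_zero]
      _ ≤ ∑ a, ‖u k a‖ ^ 2 * (p c * 2 ^ (-q c)) := by
          gcongr with a
          exact hle c _
      _ = p c * 2 ^ (-q c) := by rw [← Finset.sum_mul, hunit, one_mul]
  have hlog2 : 0 < Real.log 2 := Real.log_pos one_lt_two
  have hpw : ∀ c k, p c * (w c k / p c) = w c k := fun c k => by
    rcases (hp0 c).eq_or_lt with h | h
    · have := hwle c k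
      rw [← h, zero_mul] at this
      rw [← h, zero_mul, le_antisymm this (hw0 c k)]
    · field_simp
  have hterm : ∀ k, ∑ c, w c k * q c ≤
      -(hρ.eigenvalues k * Real.logb 2 (hρ.eigenvalues k)) := fun k => by
    have hJ := Real.concaveOn_negMulLog.le_map_sum (t := Finset.univ) (w := p)
      (p := fun c => w c k / p c) (fun c _ => hp0 c) hp1
      (fun c _ => div_nonneg (hw0 c k) (hp0 c))
    simp only [smul_eq_mul, hpw] at hJ
    rw [← heig] at hJ
    have h2 : -(hρ.eigenvalues k * Real.logb 2 (hρ.eigenvalues k)) =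
        Real.negMulLog (hρ.eigenvalues k) / Real.log 2 := by
      rw [Real.negMulLog, Real.logb]; ring
    rw [h2, le_div_iff₀ hlog2, Finset.sum_mul]
    refine le_trans (Finset.sum_le_sum fun c _ => ?_) hJ
    rw [← hpw c k, mul_assoc, mul_assoc]
    rw [hpw c k]
    refine mul_le_mul_of_nonneg_left ?_ (hp0 c)
    rcases (hw0 c k).eq_or_lt with h | h
    · simp [← h]
    have hpc : 0 < p c := by
      rcases (hp0 c).eq_or_lt with h' | h'
      · have := hwle c k
        rw [← h', zero_mul] at this
        exact absurd this (not_le.2 h)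
      · exact h'
    have hx : 0 < w c k / p c := div_pos h hpc
    have hx' : w c k / p c ≤ 2 ^ (-q c) := by
      rw [div_le_iff₀ hpc, mul_comm]; exact hwle c k
    have hl := Real.log_le_log hx hx'
    rw [Real.log_rpow two_pos] at hl
    rw [Real.negMulLog, neg_mul, ← mul_neg]
    refine mul_le_mul_of_nonneg_left ?_ hx.le
    linarith
  calc ∑ c, p c * q c = ∑ k, ∑ c, w c k * q c := by
        rw [Finset.sum_comm]
        refine Finset.sum_congr rfl fun c _ => ?_
        rw [← Finset.sum_mul, hsumw]
    _ ≤ _ := Finset.sum_le_sum fun k _ => hterm k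

theorem sum_norm_glue {S Q Ω : Type*} [Fintype S] [DecidableEq S] [Fintype Q] [Fintype Ω]
    (F : Ω → S → Q) (hF : Function.Injective F) (ψ : (S → Q) → ℂ)
    (hψ : ∀ ω, ψ (F ω) = (((Real.sqrt (Fintype.card Ω))⁻¹ : ℝ) : ℂ))
    (hψ0 : ∀ s, s ∉ Set.range F → ψ s = 0) (A : Finset S)
    (P : ({k // k ∉ A} → Q) → Prop) [DecidablePred P] :
    ∑ b with P b, ∑ a, ‖ψ (glue A a b)‖ ^ 2 =
      ({ω | P fun k => F ω k} : Finset Ω).card / (Fintype.card Ω : ℝ) := by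
  classical
  have h1 : ∑ b with P b, ∑ a, ‖ψ (glue A a b)‖ ^ 2 =
      ∑ s : S → Q, if P (fun k => s k) then ‖ψ s‖ ^ 2 else 0 := by
    rw [← (Equiv.piEquivPiSubtypeProd (· ∈ A) fun _ => Q).symm.sum_comp, Fintype.sum_prod_type,
      Finset.sum_filter]
    conv_rhs => rw [Finset.sum_comm]
    refine Finset.sum_congr rfl fun b _ => ?_
    have hb : ∀ a : {k // k ∈ A} → Q,
        (fun k : {k // k ∉ A} => (Equiv.piEquivPiSubtypeProd (· ∈ A) fun _ => Q).symm (a, b) k)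
          = b := fun a => by
      ext k; simp [Equiv.piEquivPiSubtypeProd, k.2]
    simp only [hb]
    split_ifs
    · rfl
    · simp
  rw [h1, ← Finset.sum_subset (Finset.subset_univ (Finset.univ.image F)),
    Finset.sum_image (fun _ _ _ _ h => hF h), ← Finset.sum_filter]
  · simp only [hψ]
    rw [Finset.sum_const, nsmul_eq_mul, div_eq_mul_inv]
    congr 1
    rw [Complex.norm_real, Real.norm_of_nonneg (by positivity), inv_pow, Real.sq_sqrt (by positivity)]
  · intro s _ hs
    rw [hψ0 s (by simpa using hs)]
    simp

/-- Entropy bound for a uniform superposition of basis states `F ω`, each of which has a class and a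
label: both can be read off outside `A`, and the label can be read off inside `A` when the class is
known. -/
theorem le_entanglementEntropy_of_uniform {S Q Ω C Z : Type*} [Fintype S] [DecidableEq S] [Fintype Q]
    [DecidableEq Q] [Fintype Ω] [Nonempty Ω] [Fintype C] [DecidableEq C] [DecidableEq Z]
    (F : Ω → S → Q) (hF : Function.Injective F) (ψ : (S → Q) → ℂ)
    (hψ : ∀ ω, ψ (F ω) = (((Real.sqrt (Fintype.card Ω))⁻¹ : ℝ) : ℂ))
    (hψ0 : ∀ s, s ∉ Set.range F → ψ s = 0) (A : Finset S) (cls : Ω → C) (key : Ω → Z) (q : C → ℕ)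
    (hB : ∀ ω ω', (∀ k, k ∉ A → F ω k = F ω' k) → cls ω = cls ω' ∧ key ω = key ω')
    (hA : ∀ ω ω', cls ω = cls ω' → (∀ k, k ∈ A → F ω k = F ω' k) → key ω = key ω')
    (hcard : ∀ c z, ({ω | cls ω = c ∧ key ω = z} : Finset Ω).card * 2 ^ q c ≤
      ({ω | cls ω = c} : Finset Ω).card) :
    (∑ ω, (q (cls ω) : ℝ)) / Fintype.card Ω ≤ entanglementEntropy ψ A := by
  classical
  obtain ⟨ω₀⟩ := ‹Nonempty Ω›
  have hN : (0 : ℝ) < Fintype.card Ω := by exact_mod_cast Fintype.card_pos_iff.2 ⟨ω₀⟩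
  let rB : ({k // k ∉ A} → Q) → Ω := fun b =>
    if h : ∃ ω, (fun k : {k // k ∉ A} => F ω k) = b then h.choose else ω₀
  have hrB : ∀ ω, cls (rB fun k : {k // k ∉ A} => F ω k) = cls ω ∧ key (rB fun k : {k // k ∉ A} => F ω k) = key ω := fun ω => by
    have h : ∃ ω', (fun k : {k // k ∉ A} => F ω' k) =
        fun k : {k // k ∉ A} => F ω k := ⟨ω, rfl⟩
    have h2 : rB (fun k : {k // k ∉ A} => F ω k) = h.choose := dif_pos h
    rw [h2]
    exact hB _ _ fun k hk => congrFun h.choose_spec ⟨k, hk⟩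
  let rA : C → ({k // k ∈ A} → Q) → Ω := fun c a =>
    if h : ∃ ω, cls ω = c ∧ (fun k : {k // k ∈ A} => F ω k) = a then h.choose else ω₀
  have hrA : ∀ ω, key (rA (cls ω) fun k : {k // k ∈ A} => F ω k) = key ω := fun ω => by
    have h : ∃ ω', cls ω' = cls ω ∧ (fun k : {k // k ∈ A} => F ω' k) =
        fun k : {k // k ∈ A} => F ω k := ⟨ω, rfl, rfl⟩
    have h2 : rA (cls ω) (fun k : {k // k ∈ A} => F ω k) = h.choose := dif_pos h
    rw [h2]
    exact hA _ _ h.choose_spec.1 fun k hk => congrFun h.choose_spec.2 ⟨k, hk⟩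
  have key1 := le_vonNeumannEntropy_of_labels (fun b a => ψ (glue A a b)) (reducedDensity ψ A)
    (reducedDensity_isHermitian ψ A) (fun a a' => rfl) (fun b => cls (rB b))
    (fun c a => key (rA c a)) (fun b => key (rB b))
    (fun c => ({ω | cls ω = c} : Finset Ω).card / (Fintype.card Ω : ℝ)) (fun c => (q c : ℝ))
    ?_ ?_ ?_ ?_
  · refine le_trans (le_of_eq ?_) key1
    rw [Finset.sum_div, ← Finset.sum_fiberwise _ cls]
    refine Finset.sum_congr rfl fun c _ => ?_
    rw [Finset.sum_congr rfl (g := fun _ => (q c : ℝ) / Fintype.card Ω)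
      (fun ω hω => by rw [(Finset.mem_filter.1 hω).2]), Finset.sum_const, nsmul_eq_mul]
    ring
  · intro b a hba
    have hs : glue A a b ∈ Set.range F := by
      by_contra h; exact hba (hψ0 _ h)
    obtain ⟨ω, hω⟩ := hs
    have ha : a = fun k : {k // k ∈ A} => F ω k := by
      ext k; rw [hω]; simp [glue, k.2]
    have hb : b = fun k : {k // k ∉ A} => F ω k := by
      ext k; rw [hω]; simp [glue, k.2]
    simp only [ha, hb, (hrB ω).1, (hrB ω).2, hrA]
  · intro c
    rw [sum_norm_glue F hF ψ hψ hψ0 A (fun b => cls (rB b) = c)]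
    simp only [(hrB _).1]
  · rw [← Finset.sum_div, div_eq_one_iff_eq hN.ne']
    exact_mod_cast (Finset.card_eq_sum_card_fiberwise (f := cls) (t := Finset.univ)
      (s := Finset.univ) (fun _ _ => Finset.mem_coe.2 (Finset.mem_univ _))).symm
  · intro c z
    rw [sum_norm_glue F hF ψ hψ hψ0 A (fun b => cls (rB b) = c ∧ key (rB b) = z)]
    simp only [(hrB _).1, (hrB _).2]
    rw [Real.rpow_neg zero_le_two, Real.rpow_natCast, ← div_eq_mul_inv, div_div, mul_comm, ← div_div]
    refine div_le_div_of_nonneg_right ?_ hN.le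
    rw [le_div_iff₀ (by positivity)]
    exact_mod_cast hcard c z

/-- The control states, one of which is present on each state of the path. -/
def SiteState.isControl : SiteState → Bool
  | .right _ | .dright _ | .left | .turnUp | .dturnUp | .turnDown _ => true
  | _ => false

/-- The control states that act on the particle to their right. -/
def SiteState.actsRight : SiteState → Bool
  | .right _ | .dright _ | .turnUp | .dturnUp => true
  | _ => false

theorem TransitionRule.control {a b c d : SiteState} (h : TransitionRule a b c d) :
    (a.isControl ∧ a.actsRight) ∨ (b.isControl ∧ ¬ b.actsRight) := by
  cases h <;> simp [SiteState.isControl, SiteState.actsRight]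

theorem TransitionRule.unique {a b c d c' d' : SiteState} (h : TransitionRule a b c d)
    (h' : TransitionRule a b c' d') : c = c' ∧ d = d' := by
  cases h <;> cases h' <;> exact ⟨rfl, rfl⟩

theorem ChainStep.unique {n : ℕ} {s s₁ s₂ : Fin n → SiteState}
    (hs : ∀ p q, (s p).isControl → (s q).isControl → p = q)
    (h₁ : ChainStep n s s₁) (h₂ : ChainStep n s s₂) : s₁ = s₂ := by
  obtain ⟨k, l, hkl, hr, ho⟩ := h₁
  obtain ⟨k', l', hkl', hr', ho'⟩ := h₂
  have hk : k = k' ∧ l = l' := by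
    rcases hr.control with ⟨h, hf⟩ | ⟨h, hf⟩ <;> rcases hr'.control with ⟨h', hf'⟩ | ⟨h', hf'⟩ <;>
      have := hs _ _ h h' <;> subst this
    · exact ⟨rfl, Fin.ext (by omega)⟩
    · exact absurd hf hf'
    · exact absurd hf' hf
    · exact ⟨Fin.ext (by omega), rfl⟩
  obtain ⟨rfl, rfl⟩ := hk
  obtain ⟨hc, hd⟩ := hr.unique hr'
  ext q
  by_cases hqk : q = k
  · rw [hqk, hc]
  by_cases hql : q = l
  · rw [hql, hd]
  rw [ho q hqk hql, ho' q hqk hql]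

/-- The state of site `p` when the control site is `c`, the entangled qubits on the left end at site
`k`, and those on the right begin at site `lim`. -/
def roundConf (m : ℕ) (x : ℕ → Bool) (k lim c : ℕ) (ctrl : SiteState) (p : ℕ) : SiteState :=
  if p = 0 then .leftEnd
  else if p = 2 * m + 2 then .rightEnd
  else if p = c then ctrl
  else if p ≤ k then .loE (x p)
  else if lim ≤ p then .upE (x (2 * m + 2 - p))
  else if p < c then if p ≤ m then .loU (x p) else .loW
  else if p ≤ m + 1 then .upU (x (p - 1)) else .upW

/-- The state of site `p` after `k` complete rounds and `r` further steps. -/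
def pathConf (m : ℕ) (x : ℕ → Bool) (k r p : ℕ) : SiteState :=
  if r = 0 then
    roundConf m x k (2 * m + 2 - k) (k + 1) (if k = 0 then .dturnUp else .turnUp) p
  else if r ≤ 2 * (m - k) then
    roundConf m x (k + 1) (2 * m + 2 - k) (k + 1 + r)
      (if k = 0 then .dright (x (k + 1)) else .right (x (k + 1))) p
  else if r = 2 * (m - k) + 1 then
    roundConf m x (k + 1) (2 * m + 2 - k) (2 * m + 1 - k) (.turnDown (x (k + 1))) p
  else roundConf m x (k + 1) (2 * m + 1 - k) (4 * m + 2 - 3 * k - r) .left p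

theorem pathConf_control {m : ℕ} {x : ℕ → Bool} {k r p : ℕ}
    (h : (pathConf m x k r p).isControl) :
    p = if r = 0 then k + 1 else if r ≤ 2 * (m - k) then k + 1 + r
      else if r = 2 * (m - k) + 1 then 2 * m + 1 - k else 4 * m + 2 - 3 * k - r := by
  unfold pathConf roundConf at h
  grind (splits := 40) [SiteState.isControl]

theorem chainStep_of_values {n : ℕ} {s s' : ℕ → SiteState} (c : ℕ) (hc : c + 1 < n)
    {a b a' b' : SiteState} (hr : TransitionRule a b a' b') (h1 : s c = a) (h2 : s (c + 1) = b)
    (h3 : s' c = a') (h4 : s' (c + 1) = b')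
    (ho : ∀ q, q < n → q ≠ c → q ≠ c + 1 → s' q = s q) :
    ChainStep n (fun p => s p) (fun p => s' p) := by
  refine ⟨⟨c, by omega⟩, ⟨c + 1, hc⟩, rfl, ?_, fun q h h' => ?_⟩
  · subst h1 h2 h3 h4
    exact hr
  · refine ho q q.2 (fun h0 => h (Fin.ext h0)) fun h0 => h' (Fin.ext h0)

theorem chainStep_turnUp {m : ℕ} (x : ℕ → Bool) {k : ℕ} (hk : k < m) :
    ChainStep (2 * m + 3) (fun p => pathConf m x k 0 p) (fun p => pathConf m x k 1 p) := by
  rcases Nat.eq_zero_or_pos k with h0 | h0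
  · refine chainStep_of_values (k + 1) (by omega) (.dturnUp_U (x (k + 1))) ?_ ?_ ?_ ?_ ?_ <;>
      grind (splits := 30) [pathConf, roundConf]
  · refine chainStep_of_values (k + 1) (by omega) (.turnUp_U (x (k + 1))) ?_ ?_ ?_ ?_ ?_ <;>
      grind (splits := 30) [pathConf, roundConf]

theorem chainStep_right {m : ℕ} (x : ℕ → Bool) {k r : ℕ} (hk : k < m) (hr : 1 ≤ r)
    (hr' : r < 2 * (m - k)) :
    ChainStep (2 * m + 3) (fun p => pathConf m x k r p) (fun p => pathConf m x k (r + 1) p) := by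
  rcases Nat.eq_zero_or_pos k with h0 | h0 <;> by_cases h1 : k + 1 + r ≤ m
  · refine chainStep_of_values (k + 1 + r) (by omega) (.dright_U (x (k + 1)) (x (k + 1 + r)))
      ?_ ?_ ?_ ?_ ?_ <;> grind (splits := 30) [pathConf, roundConf]
  · refine chainStep_of_values (k + 1 + r) (by omega) (.dright_W (x (k + 1)))
      ?_ ?_ ?_ ?_ ?_ <;> grind (splits := 30) [pathConf, roundConf]
  · refine chainStep_of_values (k + 1 + r) (by omega) (.right_U (x (k + 1)) (x (k + 1 + r)))
      ?_ ?_ ?_ ?_ ?_ <;> grind (splits := 30) [pathConf, roundConf]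
  · refine chainStep_of_values (k + 1 + r) (by omega) (.right_W (x (k + 1)))
      ?_ ?_ ?_ ?_ ?_ <;> grind (splits := 30) [pathConf, roundConf]

theorem chainStep_right_end {m : ℕ} (x : ℕ → Bool) {k : ℕ} (hk : k < m) :
    ChainStep (2 * m + 3) (fun p => pathConf m x k (2 * (m - k)) p)
      (fun p => pathConf m x k (2 * (m - k) + 1) p) := by
  rcases Nat.eq_zero_or_pos k with h0 | h0
  · refine chainStep_of_values (2 * m + 1 - k) (by omega) (.dright_end (x (k + 1)))
      ?_ ?_ ?_ ?_ ?_ <;> grind (splits := 30) [pathConf, roundConf]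
  · refine chainStep_of_values (2 * m + 1 - k) (by omega) (.right_E (x (k + 1)) (x k))
      ?_ ?_ ?_ ?_ ?_ <;> grind (splits := 30) [pathConf, roundConf]

theorem chainStep_turnDown {m : ℕ} (x : ℕ → Bool) {k : ℕ} (hk : k < m) :
    ChainStep (2 * m + 3) (fun p => pathConf m x k (2 * (m - k) + 1) p)
      (fun p => pathConf m x k (2 * (m - k) + 2) p) := by
  refine chainStep_of_values (2 * m - k) (by omega) (.w_turnDown (x (k + 1)))
      ?_ ?_ ?_ ?_ ?_ <;> grind (splits := 30) [pathConf, roundConf]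

theorem chainStep_left {m : ℕ} (x : ℕ → Bool) {k r : ℕ} (hk : k < m) (hr : 2 * (m - k) + 2 ≤ r)
    (hr' : r < 4 * (m - k)) :
    ChainStep (2 * m + 3) (fun p => pathConf m x k r p) (fun p => pathConf m x k (r + 1) p) := by
  by_cases h1 : 4 * m + 1 - 3 * k - r ≤ m
  · refine chainStep_of_values (4 * m + 1 - 3 * k - r) (by omega)
      (.u_left (x (4 * m + 1 - 3 * k - r))) ?_ ?_ ?_ ?_ ?_ <;> grind (splits := 30) [pathConf, roundConf]
  · refine chainStep_of_values (4 * m + 1 - 3 * k - r) (by omega) .w_left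
      ?_ ?_ ?_ ?_ ?_ <;> grind (splits := 30) [pathConf, roundConf]

theorem chainStep_left_end {m : ℕ} (x : ℕ → Bool) {k : ℕ} (hk : k < m) :
    ChainStep (2 * m + 3) (fun p => pathConf m x k (4 * (m - k)) p)
      (fun p => pathConf m x (k + 1) 0 p) := by
  refine chainStep_of_values (k + 1) (by omega) (.e_left (x (k + 1)))
      ?_ ?_ ?_ ?_ ?_ <;> grind (splits := 30) [pathConf, roundConf]

theorem chainStep_pathConf {m : ℕ} (x : ℕ → Bool) {k r : ℕ} (hk : k < m) (hr : r < 4 * (m - k)) :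
    ChainStep (2 * m + 3) (fun p => pathConf m x k r p) (fun p => pathConf m x k (r + 1) p) := by
  rcases Nat.eq_zero_or_pos r with rfl | h0
  · exact chainStep_turnUp x hk
  rcases lt_trichotomy r (2 * (m - k)) with h | rfl | h
  · exact chainStep_right x hk h0 h
  · exact chainStep_right_end x hk
  rcases (Nat.succ_le_of_lt h).eq_or_lt with rfl | h
  · exact chainStep_turnDown x hk
  · exact chainStep_left x hk h hr

theorem not_chainStep_pathConf_last (m : ℕ) (x : ℕ → Bool) (s' : Fin (2 * m + 3) → SiteState) :
    ¬ ChainStep (2 * m + 3) (fun p => pathConf m x m 0 p) s' := by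
  rintro ⟨k, l, hkl, hr, -⟩
  have hv : ∀ p, pathConf m x m 0 p = .turnUp ∨ pathConf m x m 0 p = .dturnUp → p = m + 1 :=
    fun p h => by
      have h0 : (pathConf m x m 0 p).isControl := by rcases h with h | h <;> rw [h] <;> rfl
      simpa using pathConf_control h0
  have hv2 : (pathConf m x m 0 (m + 2)) = .rightEnd ∨ ∃ y, pathConf m x m 0 (m + 2) = .upE y := by
    grind (splits := 30) [pathConf, roundConf]
  have hne : ∀ p, (pathConf m x m 0 p).isControl →
      pathConf m x m 0 p = .turnUp ∨ pathConf m x m 0 p = .dturnUp := fun p h => by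
    grind (splits := 30) [pathConf, roundConf, SiteState.isControl]
  rcases hr.control with ⟨h, -⟩ | ⟨h, h'⟩
  · have h1 := hne _ h
    have h2 := hv _ h1
    have h3 : (l : ℕ) = m + 2 := by omega
    simp only [h3] at hr
    rcases h1 with h1 | h1 <;> rcases hv2 with h4 | ⟨y, h4⟩ <;> rw [h1, h4] at hr <;> cases hr
  · rcases hne _ h with h1 | h1 <;> simp [h1, SiteState.actsRight] at h'

/-- The qubit string as a function on all sites, counted from `1`. -/
def extendBits {m : ℕ} (x : Fin m → Bool) (p : ℕ) : Bool :=
  if h : p - 1 < m then x ⟨p - 1, h⟩ else false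

theorem startState_eq (n m : ℕ) (hn : n = 2 * m + 3) (hm : m = (n - 3) / 2)
    (x : Fin ((n - 3) / 2) → Bool) :
    startState n x = fun p : Fin n => pathConf m (extendBits x) 0 0 p := by
  ext p
  have := p.2
  simp only [startState, pathConf, roundConf, extendBits]
  grind

/-- The times on the path: complete rounds and further steps of the current round. -/
abbrev PathIndex (m : ℕ) : Type := Σ k : Fin (m + 1), Fin (4 * (m - k) + 1)

/-- The state of a segment at the time `ω.1` of the path that begins with the qubits `ω.2`. -/
def segConf (n m : ℕ) (ω : PathIndex m × (Fin ((n - 3) / 2) → Bool)) (p : Fin n) : SiteState :=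
  pathConf m (extendBits ω.2) ω.1.1 ω.1.2 p

theorem pathConf_of_loE {m : ℕ} {x : ℕ → Bool} {k r p : ℕ} {y : Bool}
    (h : pathConf m x k r p = .loE y) : y = x p ∧ 1 ≤ p ∧ p ≤ if r = 0 then k else k + 1 := by
  unfold pathConf roundConf at h
  grind (splits := 40)

theorem pathConf_eq_loE {m : ℕ} (x : ℕ → Bool) {k r p : ℕ} (hk : k ≤ m) (hr : r ≤ 4 * (m - k))
    (hp : 1 ≤ p) (hp' : p ≤ if r = 0 then k else k + 1) : pathConf m x k r p = .loE (x p) := by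
  unfold pathConf roundConf
  grind (splits := 40)

theorem pathConf_eq_upE {m : ℕ} (x : ℕ → Bool) {k r q : ℕ} (hk : k ≤ m) (hr : r ≤ 4 * (m - k))
    (hq : 1 ≤ q) (hqm : q ≤ m) (h : q ≤ k ∨ q = k + 1 ∧ 2 * (m - k) + 2 ≤ r) :
    pathConf m x k r (2 * m + 2 - q) = .upE (x q) := by
  have hx : 2 * m + 2 - (2 * m + 2 - q) = q := by omega
  unfold pathConf roundConf
  grind (splits := 40)

theorem pathConf_of_upE {m : ℕ} {x : ℕ → Bool} {k r q : ℕ} {y : Bool}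
    (hk : k ≤ m) (hr : r ≤ 4 * (m - k)) (hqm : q ≤ m)
    (h : pathConf m x k r (2 * m + 2 - q) = .upE y) :
    y = x q ∧ (q ≤ k ∨ q = k + 1 ∧ 2 * (m - k) + 2 ≤ r) := by
  have hx : 2 * m + 2 - (2 * m + 2 - q) = q := by omega
  unfold pathConf roundConf at h
  grind (splits := 40)

theorem pathConf_right {m : ℕ} (x : ℕ → Bool) {k r : ℕ} (hr : 1 ≤ r) (hr' : r ≤ 2 * (m - k)) :
    pathConf m x k r (k + 1 + r) = if k = 0 then .dright (x (k + 1)) else .right (x (k + 1)) := by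
  unfold pathConf roundConf
  grind (splits := 40)

theorem pathConf_turnDown {m : ℕ} (x : ℕ → Bool) {k : ℕ} (hk : k < m) :
    pathConf m x k (2 * (m - k) + 1) (2 * m + 1 - k) = .turnDown (x (k + 1)) := by
  unfold pathConf roundConf
  grind (splits := 40)

theorem pathConf_left {m : ℕ} (x : ℕ → Bool) {k r : ℕ} (hr : 2 * (m - k) + 2 ≤ r)
    (hr' : r ≤ 4 * (m - k)) : pathConf m x k r (4 * m + 2 - 3 * k - r) = .left := by
  unfold pathConf roundConf
  grind (splits := 40)

theorem pathConf_turnUp {m : ℕ} (x : ℕ → Bool) {k : ℕ} (hk : k ≤ m) :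
    pathConf m x k 0 (k + 1) = if k = 0 then .dturnUp else .turnUp := by
  unfold pathConf roundConf
  grind (splits := 40)

theorem pathConf_of_right {m : ℕ} {x : ℕ → Bool} {k r p : ℕ} {y : Bool}
    (h : pathConf m x k r p = .right y ∨ pathConf m x k r p = .dright y) :
    y = x (k + 1) ∧ 1 ≤ r ∧ r ≤ 2 * (m - k) ∧ p = k + 1 + r := by
  unfold pathConf roundConf at h
  grind (splits := 40)

theorem pathConf_of_turnDown {m : ℕ} {x : ℕ → Bool} {k r p : ℕ} {y : Bool}
    (h : pathConf m x k r p = .turnDown y) : y = x (k + 1) ∧ r = 2 * (m - k) + 1 := by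
  unfold pathConf roundConf at h
  grind (splits := 40)

theorem pathConf_of_left {m : ℕ} {x : ℕ → Bool} {k r p : ℕ}
    (h : pathConf m x k r p = .left) : 2 * (m - k) + 2 ≤ r ∧ p = 4 * m + 2 - 3 * k - r := by
  unfold pathConf roundConf at h
  grind (splits := 40)

theorem pathConf_of_turnUp {m : ℕ} {x : ℕ → Bool} {k r p : ℕ}
    (h : pathConf m x k r p = .turnUp ∨ pathConf m x k r p = .dturnUp) : r = 0 ∧ p = k + 1 := by
  unfold pathConf roundConf at h
  grind (splits := 40)

theorem pathConf_time_le {m : ℕ} {x x' : ℕ → Bool} {k r k' r' : ℕ} (hk : k ≤ m)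
    (hr : r ≤ 4 * (m - k))
    (h : ∀ p, p < 2 * m + 3 → pathConf m x k r p = pathConf m x' k' r' p) :
    (if r = 0 then k else k + 1) ≤ if r' = 0 then k' else k' + 1 := by
  set e := if r = 0 then k else k + 1 with he
  rcases Nat.eq_zero_or_pos e with h0 | h0
  · omega
  have hem : e ≤ m := by grind
  have h1 := pathConf_eq_loE x hk hr h0 he.le
  rw [h e (by omega)] at h1
  exact (pathConf_of_loE h1).2.2

theorem pathConf_inj {m : ℕ} {x x' : ℕ → Bool} {k r k' r' : ℕ} (hk : k ≤ m) (hr : r ≤ 4 * (m - k))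
    (hk' : k' ≤ m) (hr' : r' ≤ 4 * (m - k'))
    (h : ∀ p, p < 2 * m + 3 → pathConf m x k r p = pathConf m x' k' r' p) : k = k' ∧ r = r' := by
  have he := le_antisymm (pathConf_time_le hk hr h)
    (pathConf_time_le hk' hr' fun p hp => (h p hp).symm)
  rcases Nat.eq_zero_or_pos r with rfl | h0
  · have h1 := pathConf_turnUp x hk
    rw [h _ (by omega)] at h1
    have h2 := pathConf_of_turnUp (m := m) (x := x') (k := k') (r := r') (p := k + 1) (by grind)
    omega
  rcases lt_trichotomy r (2 * (m - k) + 1) with h3 | rfl | h3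
  · have h1 := pathConf_right (m := m) x (k := k) h0 (by omega)
    rw [h _ (by omega)] at h1
    have h2 := pathConf_of_right (m := m) (x := x') (k := k') (r := r') (p := k + 1 + r)
      (y := x (k + 1)) (by grind)
    grind
  · have h1 := pathConf_turnDown (m := m) x (k := k) (by omega)
    rw [h _ (by omega)] at h1
    have h2 := pathConf_of_turnDown h1
    grind
  · have h1 := pathConf_left (m := m) x (k := k) h3 hr
    rw [h _ (by omega)] at h1
    have h2 := pathConf_of_left h1
    grind

theorem pathConf_bits {m : ℕ} {x x' : ℕ → Bool} {k r : ℕ} (hk : k ≤ m) (hr : r ≤ 4 * (m - k))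
    (h : ∀ p, p < 2 * m + 3 → pathConf m x k r p = pathConf m x' k r p) (q : ℕ) (hq : 1 ≤ q)
    (hqm : q ≤ m) : x q = x' q := by
  have h1 := h q (by omega)
  have h2 := h (q + 1) (by omega)
  unfold pathConf roundConf at h1 h2
  grind (splits := 40)

theorem segConf_injective {n m : ℕ} (hn : n = 2 * m + 3) : Function.Injective (segConf n m) := by
  rintro ⟨⟨k, r⟩, x⟩ ⟨⟨k', r'⟩, x'⟩ h
  have h' : ∀ p, p < 2 * m + 3 →
      pathConf m (extendBits x) k r p = pathConf m (extendBits x') k' r' p :=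
    fun p hp => congrFun h ⟨p, by omega⟩
  obtain ⟨h1, h2⟩ := pathConf_inj (by omega) (by omega) (by omega) (by omega) h'
  obtain rfl := Fin.ext h1
  obtain rfl := Fin.ext h2
  congr 1
  ext q
  have := pathConf_bits (by omega) (by omega) h' (q + 1) (by omega) (by omega)
  simpa [extendBits] using this

theorem startPath_eq_range {n m : ℕ} (hn : n = 2 * m + 3) (x : Fin ((n - 3) / 2) → Bool) :
    startPath n x = Set.range fun i : PathIndex m => segConf n m (i, x) := by
  subst hn
  set y := extendBits x with hy
  apply Set.Subset.antisymm
  · intro s hs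
    induction hs with
    | refl => exact ⟨⟨0, 0⟩, (startState_eq _ m rfl (by omega) x).symm⟩
    | @tail b c _ hbc ih =>
      obtain ⟨⟨k, r⟩, rfl⟩ := ih
      have huniq : ∀ p q : Fin (2 * m + 3), (segConf (2 * m + 3) m (⟨k, r⟩, x) p).isControl →
          (segConf (2 * m + 3) m (⟨k, r⟩, x) q).isControl → p = q := fun p q hp hq =>
        Fin.ext ((pathConf_control hp).trans (pathConf_control hq).symm)
      have hk := k.2
      have hr := r.2
      by_cases hlt : (r : ℕ) < 4 * (m - k)
      · have h1 := chainStep_pathConf y (k := k) (r := r) (by omega) hlt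
        exact ⟨⟨k, ⟨r + 1, by omega⟩⟩, ChainStep.unique huniq h1 hbc⟩
      have hr' : (r : ℕ) = 4 * (m - k) := by omega
      by_cases hkm : (k : ℕ) < m
      · have h1 := chainStep_left_end y hkm
        rw [← hr'] at h1
        exact ⟨⟨⟨k + 1, by omega⟩, 0⟩, ChainStep.unique huniq h1 hbc⟩
      · have hk' : (k : ℕ) = m := by omega
        refine absurd hbc ?_
        have : segConf (2 * m + 3) m (⟨k, r⟩, x) =
            fun p : Fin (2 * m + 3) => pathConf m y m 0 p := by
          ext p
          simp only [segConf, hr', hk', Nat.sub_self, Nat.mul_zero, ← hy]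
        simp only [this]
        exact not_chainStep_pathConf_last m y c
  · have key : ∀ k, k ≤ m → ∀ r, r ≤ 4 * (m - k) →
        (fun p : Fin (2 * m + 3) => pathConf m y k r p) ∈ startPath (2 * m + 3) x := by
      intro k
      induction k with
      | zero =>
        intro _ r
        induction r with
        | zero =>
          intro _
          rw [hy, ← startState_eq _ m rfl (by omega) x]
          exact Relation.ReflTransGen.refl
        | succ r ih =>
          intro hr
          exact (ih (by omega)).tail (chainStep_pathConf y (by omega) (by omega))
      | succ k ihk =>
        intro hk r
        induction r with
        | zero =>
          intro _
          exact (ihk (by omega) _ le_rfl).tail (chainStep_left_end y (by omega))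
        | succ r ih =>
          intro hr
          exact (ih (by omega)).tail (chainStep_pathConf y (by omega) (by omega))
    rintro _ ⟨⟨k, r⟩, rfl⟩
    exact key k (by omega) r (by omega)

theorem phiPath_segConf {n m : ℕ} (hn : n = 2 * m + 3) (x x' : Fin ((n - 3) / 2) → Bool)
    (i : PathIndex m) : phiPath n x' (segConf n m (i, x)) =
      if x' = x then (((Real.sqrt (Fintype.card (PathIndex m)))⁻¹ : ℝ) : ℂ) else 0 := by
  have hinj : Function.Injective fun i : PathIndex m => segConf n m (i, x') := fun a b h => by
    simpa using segConf_injective hn h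
  have hc : (startPath n x').ncard = Fintype.card (PathIndex m) := by
    rw [startPath_eq_range hn, ← Set.image_univ, Set.ncard_image_of_injective _ hinj,
      Set.ncard_univ, Nat.card_eq_fintype_card]
  have hmem : segConf n m (i, x) ∈ startPath n x' ↔ x' = x := by
    rw [startPath_eq_range hn]
    constructor
    · rintro ⟨j, hj⟩
      exact (Prod.ext_iff.1 (segConf_injective hn hj)).2
    · rintro rfl
      exact ⟨i, rfl⟩
  simp only [phiPath, hmem, hc]

theorem phiGround_segConf {n m : ℕ} (hn : n = 2 * m + 3)
    (ω : PathIndex m × (Fin ((n - 3) / 2) → Bool)) : phiGround n (segConf n m ω) =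
      (((Real.sqrt (Fintype.card (PathIndex m × (Fin ((n - 3) / 2) → Bool))))⁻¹ : ℝ) : ℂ) := by
  obtain ⟨i, x⟩ := ω
  simp only [phiGround, phiPath_segConf hn, Finset.sum_ite_eq', Finset.mem_univ, if_true]
  rw [← Complex.ofReal_mul, ← mul_inv, ← Real.sqrt_mul (by positivity), Fintype.card_prod,
    Fintype.card_fun, Fintype.card_bool, Fintype.card_fin]
  push_cast
  rw [mul_comm]

theorem phiGround_eq_zero {n m : ℕ} (hn : n = 2 * m + 3) (s : Fin n → SiteState)
    (hs : s ∉ Set.range (segConf n m)) : phiGround n s = 0 := by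
  rw [phiGround, Finset.sum_eq_zero, mul_zero]
  intro x _
  rw [phiPath, if_neg]
  rw [startPath_eq_range hn]
  rintro ⟨i, rfl⟩
  exact hs ⟨_, rfl⟩

theorem sum_path_times (m : ℕ) : ∑ k ∈ Finset.range (m + 1), (4 * (m - k) + 1) =
    (m + 1) * (2 * m + 1) := by
  induction m with
  | zero => rfl
  | succ m ih =>
    rw [Finset.sum_range_succ']
    simp only [Nat.succ_sub_succ, ih]
    simp
    ring

theorem card_pathIndex (m : ℕ) : Fintype.card (PathIndex m) = (m + 1) * (2 * m + 1) := by
  rw [Fintype.card_sigma]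
  simp only [Fintype.card_fin]
  rw [Fin.sum_univ_eq_sum_range (fun k => 4 * (m - k) + 1), sum_path_times]

open Classical in
/-- At least a quarter of the times on the path come after the qubit `K ≤ (m + 1) / 2` is entangled. -/
theorem card_pathIndex_le {m K : ℕ} (hK : 1 ≤ K) (hKm : K ≤ m) (hKm' : 2 * K ≤ m + 1)
    (P : PathIndex m → Prop)
    (hP : ∀ i : PathIndex m,
      (K ≤ i.1 ∨ K = i.1 + 1 ∧ 2 * (m - i.1) + 2 ≤ i.2) → P i) :
    Fintype.card (PathIndex m) ≤ 4 * ({i | P i} : Finset (PathIndex m)).card := by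
  classical
  obtain ⟨K, rfl⟩ : ∃ K', K = K' + 1 := ⟨K - 1, by omega⟩
  obtain ⟨j, hm⟩ : ∃ j, m = K + 1 + j := ⟨m - (K + 1), by omega⟩
  let g : ℕ → ℕ := fun k => if K + 1 ≤ k then 4 * (m - k) + 1 else if K = k then 2 * j + 1 else 0
  have hsub : (Finset.univ.sigma fun k : Fin (m + 1) => ({r | K + 1 ≤ (k : ℕ) ∨
      K + 1 = (k : ℕ) + 1 ∧ 2 * (m - k) + 2 ≤ (r : ℕ)} : Finset (Fin (4 * (m - k) + 1)))) ⊆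
      ({i | P i} : Finset (PathIndex m)) := by
    intro i hi
    simp only [Finset.mem_sigma, Finset.mem_filter, Finset.mem_univ, true_and] at hi ⊢
    exact hP i hi
  have h1 := Finset.card_le_card hsub
  rw [Finset.card_sigma] at h1
  have h2 : ∑ k : Fin (m + 1), g k ≤ ({i | P i} : Finset (PathIndex m)).card := by
    refine le_trans (Finset.sum_le_sum fun k _ => ?_) h1
    simp only [g]
    split_ifs with h3 h4
    · rw [Finset.filter_true_of_mem fun r _ => Or.inl h3, Finset.card_univ, Fintype.card_fin]
    · have h5 : 2 * (m - k) + 2 < 4 * (m - k) + 1 := by omega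
      refine le_trans ?_ (Finset.card_le_card
        (s := Finset.Ici (⟨2 * (m - k) + 2, h5⟩ : Fin (4 * (m - k) + 1))) fun r hr => ?_)
      · rw [Fin.card_Ici]
        simp only
        omega
      · rw [Finset.mem_Ici, Fin.le_def] at hr
        exact Finset.mem_filter.2 ⟨Finset.mem_univ _, Or.inr ⟨by omega, hr⟩⟩
    · exact Nat.zero_le _
  have h3 : ∑ k : Fin (m + 1), g k = (2 * j + 1) + (j + 1) * (2 * j + 1) := by
    rw [Fin.sum_univ_eq_sum_range g, show m + 1 = (K + 1) + (j + 1) by omega,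
      Finset.sum_range_add, Finset.sum_range_succ, Finset.sum_eq_zero, ← sum_path_times j]
    · simp only [g, zero_add]
      congr 1
      · simp
      · refine Finset.sum_congr rfl fun i _ => ?_
        rw [if_pos (by omega)]
        omega
    · intro k hk
      have := Finset.mem_range.1 hk
      simp only [g]
      rw [if_neg (by omega), if_neg (by omega)]
  rw [card_pathIndex]
  have h4 : m ≤ 2 * j + 1 := by omega
  nlinarith [Nat.mul_le_mul (Nat.succ_le_succ h4) (Nat.succ_le_succ (Nat.mul_le_mul_left 2 h4))]

/-- A set of times of the path of a segment and a set of qubits such that outside `A` one can see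
whether the time is in the set, and then the qubits can be read off both inside and outside `A`. -/
structure IsSharedLate (n m : ℕ) (A : ℕ → Prop) (late : PathIndex m → Prop)
    (Q : Finset (Fin ((n - 3) / 2))) : Prop where
  late_iff : ∀ ω ω', (∀ p : Fin n, ¬ A p → segConf n m ω p = segConf n m ω' p) →
    (late ω.1 ↔ late ω'.1)
  outside : ∀ ω ω', (∀ p : Fin n, ¬ A p → segConf n m ω p = segConf n m ω' p) → late ω.1 →
    late ω'.1 → ∀ q ∈ Q, ω.2 q = ω'.2 q
  inside : ∀ ω ω', (∀ p : Fin n, A p → segConf n m ω p = segConf n m ω' p) → late ω.1 →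
    late ω'.1 → ∀ q ∈ Q, ω.2 q = ω'.2 q

theorem extendBits_succ {m : ℕ} (x : Fin m → Bool) (q : Fin m) : extendBits x (q + 1) = x q := by
  simp [extendBits]

theorem isSharedLate_left {n m : ℕ} (hn : n = 2 * m + 3) (A : ℕ → Prop)
    (Q : Finset (Fin ((n - 3) / 2))) (K : ℕ) (hK : 1 ≤ K) (hKm : K ≤ m)
    (hKA : ¬ A (2 * m + 2 - K))
    (hQ : ∀ q ∈ Q, q + 1 ≤ K ∧ A (q + 1) ∧ ¬ A (2 * m + 2 - (q + 1))) :
    IsSharedLate n m A (fun i => K ≤ i.1 ∨ K = i.1 + 1 ∧ 2 * (m - i.1) + 2 ≤ i.2) Q := by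
  have hlate : ∀ ω ω', (∀ p : Fin n, ¬ A p → segConf n m ω p = segConf n m ω' p) →
      (K ≤ ω.1.1 ∨ K = ω.1.1 + 1 ∧ 2 * (m - ω.1.1) + 2 ≤ ω.1.2) →
      (K ≤ ω'.1.1 ∨ K = ω'.1.1 + 1 ∧ 2 * (m - ω'.1.1) + 2 ≤ ω'.1.2) := by
    rintro ⟨⟨k, r⟩, x⟩ ⟨⟨k', r'⟩, x'⟩ h hl
    have h1 := h ⟨2 * m + 2 - K, by omega⟩ hKA
    simp only [segConf] at h1 hl ⊢
    rw [pathConf_eq_upE _ (by omega) (by omega) hK hKm hl] at h1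
    exact (pathConf_of_upE (by omega) (by omega) hKm h1.symm).2
  refine ⟨fun ω ω' h => ⟨hlate ω ω' h, hlate ω' ω fun p hp => (h p hp).symm⟩, ?_, ?_⟩
  · rintro ⟨⟨k, r⟩, x⟩ ⟨⟨k', r'⟩, x'⟩ h hl hl' q hq
    obtain ⟨hqK, -, hqA⟩ := hQ q hq
    have h1 := h ⟨2 * m + 2 - (q + 1), by omega⟩ hqA
    simp only [segConf] at h1 hl hl' ⊢
    rw [pathConf_eq_upE _ (by omega) (by omega) (by omega) (by omega) (by omega),
      pathConf_eq_upE _ (by omega) (by omega) (by omega) (by omega) (by omega)] at h1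
    simpa [extendBits_succ] using h1
  · rintro ⟨⟨k, r⟩, x⟩ ⟨⟨k', r'⟩, x'⟩ h hl hl' q hq
    obtain ⟨hqK, hqA, -⟩ := hQ q hq
    have h1 := h ⟨q + 1, by omega⟩ hqA
    simp only [segConf] at h1 hl hl' ⊢
    rw [pathConf_eq_loE _ (by omega) (by omega) (by omega) (by split_ifs <;> omega),
      pathConf_eq_loE _ (by omega) (by omega) (by omega) (by split_ifs <;> omega)] at h1
    simpa [extendBits_succ] using h1

theorem isSharedLate_right {n m : ℕ} (hn : n = 2 * m + 3) (A : ℕ → Prop)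
    (hA : ∀ p q s, p < q → q < s → s < n → A p → A s → A q)
    (Q : Finset (Fin ((n - 3) / 2))) (K : ℕ) (hK : 1 ≤ K) (hKm : K ≤ m)
    (hKA : ¬ A K) (hKA' : A (2 * m + 2 - K))
    (hQ : ∀ q ∈ Q, q + 1 ≤ K ∧ ¬ A (q + 1) ∧ A (2 * m + 2 - (q + 1))) :
    IsSharedLate n m A
      (fun i => K ≤ i.1 ∨ K = i.1 + 1 ∧ 1 ≤ (i.2 : ℕ) ∧
        ((i.2 : ℕ) ≤ 2 * (m - i.1) → A (i.1 + 1 + i.2))) Q := by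
  have hlate : ∀ ω ω', (∀ p : Fin n, ¬ A p → segConf n m ω p = segConf n m ω' p) →
      (K ≤ ω.1.1 ∨ K = ω.1.1 + 1 ∧ 1 ≤ (ω.1.2 : ℕ) ∧
        ((ω.1.2 : ℕ) ≤ 2 * (m - ω.1.1) → A (ω.1.1 + 1 + ω.1.2))) →
      (K ≤ ω'.1.1 ∨ K = ω'.1.1 + 1 ∧ 1 ≤ (ω'.1.2 : ℕ) ∧
        ((ω'.1.2 : ℕ) ≤ 2 * (m - ω'.1.1) → A (ω'.1.1 + 1 + ω'.1.2))) := by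
    rintro ⟨⟨k, r⟩, x⟩ ⟨⟨k', r'⟩, x'⟩ h hl
    simp only [segConf] at h hl ⊢
    have h1 := h ⟨K, by omega⟩ hKA
    simp only at h1
    rw [pathConf_eq_loE _ (by omega) (by omega) hK (by split_ifs <;> omega)] at h1
    have h2 := (pathConf_of_loE h1.symm).2.2
    by_cases hk' : K ≤ k'
    · exact Or.inl hk'
    have hr0 : (r' : ℕ) ≠ 0 := fun h0 => by rw [if_pos h0] at h2; omega
    rw [if_neg hr0] at h2
    refine Or.inr ⟨by omega, by omega, fun hr2 => ?_⟩
    by_contra hnA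
    have h3 := h ⟨(k' : ℕ) + 1 + r', by omega⟩ hnA
    simp only at h3
    rw [pathConf_right _ (by omega) hr2] at h3
    have h4 : (extendBits x' (k' + 1)) = extendBits x (k + 1) ∧ 1 ≤ (r : ℕ) ∧
        (r : ℕ) ≤ 2 * (m - k) ∧ (k' : ℕ) + 1 + r' = k + 1 + r := by
      refine pathConf_of_right ?_
      split_ifs at h3
      · exact Or.inr h3
      · exact Or.inl h3
    obtain ⟨-, h5, h6, h7⟩ := h4
    rcases hl with hl | ⟨hl, -, hl2⟩
    · have hnA2 : ¬ A (K + 1) := by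
        intro hA1
        rcases (show (k' : ℕ) + 1 + r' = K + 1 ∨ K + 1 < (k' : ℕ) + 1 + r' by omega) with h8 | h8
        · exact hnA (h8 ▸ hA1)
        · rcases (show (k' : ℕ) + 1 + r' = 2 * m + 2 - K ∨ (k' : ℕ) + 1 + r' < 2 * m + 2 - K by omega)
            with h9 | h9
          · exact hnA (h9 ▸ hKA')
          · exact hnA (hA _ _ _ h8 h9 (by omega) hA1 hKA')
      have h8 := h ⟨K + 1, by omega⟩ hnA2
      simp only at h8
      rw [pathConf_eq_loE _ (by omega) (by omega) (by omega) (by split_ifs <;> omega)] at h8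
      have h9 := (pathConf_of_loE h8.symm).2.2
      split_ifs at h9 <;> omega
    · exact hnA (h7 ▸ hl2 h6)
  refine ⟨fun ω ω' h => ⟨hlate ω ω' h, hlate ω' ω fun p hp => (h p hp).symm⟩, ?_, ?_⟩
  · rintro ⟨⟨k, r⟩, x⟩ ⟨⟨k', r'⟩, x'⟩ h hl hl' q hq
    obtain ⟨hqK, hqA, -⟩ := hQ q hq
    have h1 := h ⟨q + 1, by omega⟩ hqA
    simp only [segConf] at h1 hl hl' ⊢
    rw [pathConf_eq_loE _ (by omega) (by omega) (by omega) (by split_ifs <;> omega),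
      pathConf_eq_loE _ (by omega) (by omega) (by omega) (by split_ifs <;> omega)] at h1
    simpa [extendBits_succ] using h1
  · have hcontrol : ∀ (k : Fin (m + 1)) (r : Fin (4 * (m - k) + 1)) x x' k' (r' : ℕ), k' ≤ m →
        r' ≤ 4 * (m - k') → (∀ p : Fin n, A p → pathConf m (extendBits x) k r p =
          pathConf m (extendBits x') k' r' p) →
        (K ≤ k ∨ K = k + 1 ∧ 1 ≤ (r : ℕ) ∧ ((r : ℕ) ≤ 2 * (m - k) → A (k + 1 + r))) →
        (K ≤ k' ∨ K = k' + 1) →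
        extendBits (m := (n - 3) / 2) x K = extendBits (m := (n - 3) / 2) x' K := by
      intro k r x x' k' r' hk' hr' h hl hl'
      by_cases hE : K ≤ k ∨ K = k + 1 ∧ 2 * (m - k) + 2 ≤ r
      · have h1 := h ⟨2 * m + 2 - K, by omega⟩ hKA'
        simp only at h1
        rw [pathConf_eq_upE _ (by omega) (by omega) hK hKm hE] at h1
        exact (pathConf_of_upE hk' hr' hKm h1.symm).1
      have hE' : ¬ (K ≤ k' ∨ K = k' + 1 ∧ 2 * (m - k') + 2 ≤ r') := by
        intro hE'
        have h1 := h ⟨2 * m + 2 - K, by omega⟩ hKA'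
        simp only at h1
        rw [pathConf_eq_upE (k := k') _ (by omega) (by omega) hK hKm hE'] at h1
        exact hE (pathConf_of_upE (by omega) (by omega) hKm h1).2
      obtain ⟨hk, hr1, hrA⟩ := hl.resolve_left fun h => hE (Or.inl h)
      have hkk : k' = k := by omega
      subst hkk
      rw [hk]
      rcases (show (r : ℕ) ≤ 2 * (m - k) ∨ (r : ℕ) = 2 * (m - k) + 1 by omega) with h3 | h3
      · have h1 := h ⟨(k : ℕ) + 1 + r, by omega⟩ (hrA h3)
        simp only at h1
        rw [pathConf_right _ hr1 h3] at h1
        refine (pathConf_of_right (m := m) (p := k + 1 + r) (k := k) (r := r') ?_).1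
        split_ifs at h1
        · exact Or.inr h1.symm
        · exact Or.inl h1.symm
      · have h1 := h ⟨2 * m + 1 - k, by omega⟩
          (show A (2 * m + 1 - k) from
            (show 2 * m + 1 - (k : ℕ) = 2 * m + 2 - K by omega) ▸ hKA')
        simp only at h1
        rw [h3, pathConf_turnDown _ (by omega)] at h1
        exact (pathConf_of_turnDown h1.symm).1
    rintro ⟨⟨k, r⟩, x⟩ ⟨⟨k', r'⟩, x'⟩ h hl hl' q hq
    obtain ⟨hqK, -, hqA⟩ := hQ q hq
    simp only [segConf] at h hl hl' ⊢
    rcases (show (q : ℕ) + 1 = K ∨ q + 1 < K by omega) with hqK' | hqK'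
    · have h1 := hcontrol k r x x' k' r' (by omega) (by omega) h hl (by omega)
      rwa [← hqK', extendBits_succ, extendBits_succ] at h1
    · have h1 := h ⟨2 * m + 2 - (q + 1), by omega⟩ hqA
      simp only at h1
      rw [pathConf_eq_upE _ (by omega) (by omega) (by omega) (by omega) (by omega),
        pathConf_eq_upE _ (by omega) (by omega) (by omega) (by omega) (by omega)] at h1
      simpa [extendBits_succ] using h1

open Classical in
/-- The good particles of one segment, when `A` is its intersection with the given set. -/
noncomputable def segmentGood (n : ℕ) (A : ℕ → Prop) : Finset (Fin n) :=
  {p | ((1 ≤ (p : ℕ) ∧ 4 * ((p : ℕ) + 1) ≤ n) ∨ (3 * n ≤ 4 * ((p : ℕ) + 1) ∧ (p : ℕ) + 2 ≤ n)) ∧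
    A p ∧ ¬ A (n - 1 - p)}

theorem mem_segmentGood {n : ℕ} {A : ℕ → Prop} {p : Fin n} : p ∈ segmentGood n A ↔
    ((1 ≤ (p : ℕ) ∧ 4 * ((p : ℕ) + 1) ≤ n) ∨ (3 * n ≤ 4 * ((p : ℕ) + 1) ∧ (p : ℕ) + 2 ≤ n)) ∧
      A p ∧ ¬ A (n - 1 - p) := by
  simp [segmentGood]

open Classical in
theorem exists_isSharedLate {n m : ℕ} (hn : n = 2 * m + 3) (A : ℕ → Prop)
    (hA : ∀ p q s, p < q → q < s → s < n → A p → A s → A q) :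
    ∃ (late : PathIndex m → Prop) (Q : Finset (Fin ((n - 3) / 2))), IsSharedLate n m A late Q ∧
      (segmentGood n A).card ≤ Q.card ∧
      Fintype.card (PathIndex m) ≤ 4 * ({i | late i} : Finset (PathIndex m)).card := by
  rcases (segmentGood n A).eq_empty_or_nonempty with h0 | ⟨p₀, hp₀⟩
  · refine ⟨fun _ => True, ∅, ⟨by simp, by simp, by simp⟩, by simp [h0], ?_⟩
    simp only [Finset.filter_true, Finset.card_univ]
    omega
  by_cases hL : ∃ p ∈ segmentGood n A, 4 * ((p : ℕ) + 1) ≤ n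
  · obtain ⟨p, hp, hpn⟩ := hL
    have hall : ∀ p' ∈ segmentGood n A, 1 ≤ (p' : ℕ) ∧ 4 * ((p' : ℕ) + 1) ≤ n := by
      intro p' hp'
      obtain ⟨h | h, hA1, hA2⟩ := mem_segmentGood.1 hp'
      · exact h
      · exfalso
        obtain ⟨-, hA3, hA4⟩ := mem_segmentGood.1 hp
        rcases lt_trichotomy (n - 1 - (p' : ℕ)) p with h1 | h1 | h1
        · exact hA4 (hA p _ p' (by omega) (by omega) p'.2 hA3 hA1)
        · exact hA2 (h1 ▸ hA3)
        · exact hA2 (hA p _ p' h1 (by omega) p'.2 hA3 hA1)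
    let Q : Finset (Fin ((n - 3) / 2)) := {q | 4 * ((q : ℕ) + 2) ≤ n ∧ A (q + 1) ∧
      ¬ A (2 * m + 2 - (q + 1))}
    have hQ : ∀ q, q ∈ Q ↔ 4 * ((q : ℕ) + 2) ≤ n ∧ A (q + 1) ∧ ¬ A (2 * m + 2 - (q + 1)) :=
      fun q => by simp [Q]
    have hcard : (segmentGood n A).card ≤ Q.card := by
      refine Finset.card_le_card_of_injOn
        (fun p => if h : (p : ℕ) - 1 < (n - 3) / 2 then ⟨p - 1, h⟩ else ⟨0, by omega⟩) ?_ ?_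
      · intro p' hp'
        have h1 := hall p' hp'
        obtain ⟨-, hA1, hA2⟩ := mem_segmentGood.1 hp'
        beta_reduce
        rw [dif_pos (by omega)]
        refine (hQ _).2 ⟨by simp only; omega, ?_, ?_⟩
        · simpa only [Nat.sub_add_cancel h1.1] using hA1
        · simp only [Nat.sub_add_cancel h1.1]
          rwa [show 2 * m + 2 - (p' : ℕ) = n - 1 - p' by omega]
      · intro p₁ h₁ p₂ h₂ h
        have h3 := hall p₁ h₁
        have h4 := hall p₂ h₂
        simp only at h
        rw [dif_pos (by omega), dif_pos (by omega)] at h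
        have := congrArg Fin.val h
        simp only at this
        exact Fin.ext (by omega)
    obtain ⟨K, hK, hmax⟩ := Q.exists_max_image (fun q => (q : ℕ))
      (Finset.card_pos.1 (lt_of_lt_of_le (Finset.card_pos.2 ⟨p₀, hp₀⟩) hcard))
    obtain ⟨hK1, -, hK2⟩ := (hQ K).1 hK
    refine ⟨_, Q, isSharedLate_left hn A Q (K + 1) (by omega) (by omega) hK2 fun q hq => ?_,
      hcard, ?_⟩
    · obtain ⟨-, h1, h2⟩ := (hQ q).1 hq
      exact ⟨Nat.succ_le_succ (hmax q hq), h1, h2⟩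
    · exact card_pathIndex_le (K := K + 1) (by omega) (by omega) (by omega) _ fun i hi => hi
  · have hall : ∀ p' ∈ segmentGood n A, 3 * n ≤ 4 * ((p' : ℕ) + 1) ∧ (p' : ℕ) + 2 ≤ n := by
      intro p' hp'
      obtain ⟨h | h, -⟩ := mem_segmentGood.1 hp'
      · exact absurd ⟨p', hp', h.2⟩ hL
      · exact h
    let Q : Finset (Fin ((n - 3) / 2)) := {q | 4 * ((q : ℕ) + 1) ≤ n ∧ ¬ A (q + 1) ∧
      A (2 * m + 2 - (q + 1))}
    have hQ : ∀ q, q ∈ Q ↔ 4 * ((q : ℕ) + 1) ≤ n ∧ ¬ A (q + 1) ∧ A (2 * m + 2 - (q + 1)) :=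
      fun q => by simp [Q]
    have hcard : (segmentGood n A).card ≤ Q.card := by
      refine Finset.card_le_card_of_injOn
        (fun p => if h : 2 * m + 1 - (p : ℕ) < (n - 3) / 2 then ⟨2 * m + 1 - p, h⟩ else
          ⟨0, by have := hall p₀ hp₀; omega⟩) ?_ ?_
      · intro p' hp'
        have h1 := hall p' hp'
        obtain ⟨-, hA1, hA2⟩ := mem_segmentGood.1 hp'
        beta_reduce
        rw [dif_pos (by omega)]
        have h2 : 2 * m + 1 - (p' : ℕ) + 1 = n - 1 - p' := by omega
        refine (hQ _).2 ⟨by simp only; omega, ?_, ?_⟩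
        · simpa only [h2] using hA2
        · simp only [h2]
          rwa [show 2 * m + 2 - (n - 1 - (p' : ℕ)) = p' by omega]
      · intro p₁ h₁ p₂ h₂ h
        have h3 := hall p₁ h₁
        have h4 := hall p₂ h₂
        simp only at h
        rw [dif_pos (by omega), dif_pos (by omega)] at h
        have := congrArg Fin.val h
        simp only at this
        exact Fin.ext (by omega)
    obtain ⟨K, hK, hmax⟩ := Q.exists_max_image (fun q => (q : ℕ))
      (Finset.card_pos.1 (lt_of_lt_of_le (Finset.card_pos.2 ⟨p₀, hp₀⟩) hcard))
    obtain ⟨hK1, hK2, hK3⟩ := (hQ K).1 hK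
    refine ⟨_, Q, isSharedLate_right hn A hA Q (K + 1) (by omega) (by omega) hK2 hK3 fun q hq => ?_,
      hcard, ?_⟩
    · obtain ⟨-, h1, h2⟩ := (hQ q).1 hq
      exact ⟨Nat.succ_le_succ (hmax q hq), h1, h2⟩
    · refine card_pathIndex_le (K := K + 1) (by omega) (by omega) (by omega) _ fun i hi => ?_
      rcases hi with hi | ⟨hi, hi'⟩
      · exact Or.inl hi
      · exact Or.inr ⟨hi, by omega, fun h => absurd h (by omega)⟩

theorem segmentSite_bijective (n t : ℕ) [NeZero (n * t)] (i : Fin n) :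
    Function.Bijective fun jp : Fin t × Fin n => segmentSite n t i jp.1 (jp.2 + 1) := by
  rw [Fintype.bijective_iff_injective_and_card]
  refine ⟨?_, by simp [mul_comm]⟩
  rintro ⟨j, p⟩ ⟨j', p'⟩ h
  have hn : 0 < n := i.pos
  have hlt : ∀ (j : Fin t) (p : Fin n), (j : ℕ) * n + p < n * t := fun j p => by
    have := Nat.mul_le_mul_right n (Nat.succ_le_of_lt j.2)
    rw [Nat.succ_mul, mul_comm t n] at this
    omega
  have h1 : ((i : ℕ) + j * n + p) ≡ (i + j' * n + p') [MOD n * t] := congrArg Fin.val h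
  rw [add_assoc, add_assoc] at h1
  have h2 := (Nat.ModEq.add_left_cancel' _ h1).eq_of_lt_of_lt (hlt j p) (hlt j' p')
  have h3 : (p : ℕ) = p' := by
    have := congrArg (· % n) h2
    simpa [Nat.mod_eq_of_lt] using this
  have h4 : (j : ℕ) = j' := Nat.eq_of_mul_eq_mul_right hn (by omega)
  exact Prod.ext (Fin.ext h4) (Fin.ext h3)

theorem mem_arc_iff {N : ℕ} [NeZero N] (a : Fin N) {r : ℕ} (hr : r ≤ N) (d : ℕ) (hd : d < N) :
    Fin.ofNat N (a + d) ∈ arc a r ↔ d < r := by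
  simp only [arc, Finset.mem_image, Finset.mem_range]
  constructor
  · rintro ⟨k, hk, h⟩
    have h1 : (a : ℕ) + k ≡ a + d [MOD N] := congrArg Fin.val h
    rwa [← (Nat.ModEq.add_left_cancel' _ h1).eq_of_lt_of_lt (by omega) hd]
  · exact fun h => ⟨d, h, rfl⟩

theorem arc_segment_convex (n t : ℕ) [NeZero (n * t)] (i : Fin n) (a : Fin (n * t)) (r : ℕ)
    (hr : r + n ≤ n * t) (j p q s : ℕ) (hpq : p < q) (hqs : q < s) (hs : s < n)
    (hp : segmentSite n t i j (p + 1) ∈ arc a r) (hs' : segmentSite n t i j (s + 1) ∈ arc a r) :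
    segmentSite n t i j (q + 1) ∈ arc a r := by
  obtain ⟨d, hd, hpd⟩ := Finset.mem_image.1 hp
  have hd := Finset.mem_range.1 hd
  have hval : (a : ℕ) + d ≡ i + j * n + p [MOD n * t] := congrArg Fin.val hpd
  have hsite : ∀ e, segmentSite n t i j (p + e + 1) = Fin.ofNat (n * t) (a + (d + e)) := by
    intro e
    apply Fin.ext
    have : (i : ℕ) + j * n + (p + e) ≡ a + (d + e) [MOD n * t] := by
      simpa only [add_assoc] using (hval.add_right e).symm
    exact this
  have h1 := hsite (s - p)
  have h2 := hsite (q - p)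
  rw [show p + (s - p) = s by omega] at h1
  rw [show p + (q - p) = q by omega] at h2
  rw [h1, mem_arc_iff a (by omega) _ (by omega)] at hs'
  rw [h2, mem_arc_iff a (by omega) _ (by omega)]
  omega

theorem card_goodParticles_le (n t : ℕ) [NeZero (n * t)] (i : Fin n) (A : Finset (Fin (n * t))) :
    (goodParticles n t i A).card ≤
      ∑ j : Fin t, (segmentGood n fun p => segmentSite n t i j (p + 1) ∈ A).card := by
  classical
  have hsub : goodParticles n t i A ⊆ Finset.univ.biUnion fun j : Fin t =>
      (segmentGood n fun p => segmentSite n t i j (p + 1) ∈ A).image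
        fun p : Fin n => segmentSite n t i j (p + 1) := by
    intro k hk
    obtain ⟨hkA, j, p, hj, rfl, hp, hpA⟩ := Finset.mem_filter.1 hk
    have hp' : (2 ≤ p ∧ 4 * p ≤ n) ∨ (3 * n ≤ 4 * p ∧ p + 1 ≤ n) := by
      refine hp.imp (And.imp_right fun h => ?_) (And.imp_left fun h => ?_)
      · have : (4 * p : ℝ) ≤ n := by linarith
        exact_mod_cast this
      · have : (3 * n : ℝ) ≤ 4 * p := by linarith
        exact_mod_cast this
    have hn := i.pos
    obtain ⟨p, rfl⟩ : ∃ p', p = p' + 1 := ⟨p - 1, by omega⟩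
    refine Finset.mem_biUnion.2 ⟨⟨j, hj⟩, Finset.mem_univ _,
      Finset.mem_image.2 ⟨⟨p, by omega⟩, ?_, rfl⟩⟩
    refine mem_segmentGood.2 ⟨by simp only; omega, hkA, ?_⟩
    simp only
    rwa [show n - 1 - p + 1 = n + 1 - (p + 1) by omega]
  exact (Finset.card_le_card hsub).trans (Finset.card_biUnion_le.trans
    (Finset.sum_le_sum fun j _ => Finset.card_image_le))

theorem card_pi_le_of_card_le {ι Y : Type*} [Fintype ι] [DecidableEq ι] [Fintype Y] (P : Y → Prop)
    [DecidablePred P] (h : Fintype.card Y ≤ 4 * ({y | P y} : Finset Y).card) (j : ι) :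
    Fintype.card (ι → Y) ≤ 4 * ({ω | P (ω j)} : Finset (ι → Y)).card := by
  have h1 : ({ω | P (ω j)} : Finset (ι → Y)) =
      Fintype.piFinset fun k => if k = j then ({y | P y} : Finset Y) else Finset.univ := by
    ext ω
    simp only [Finset.mem_filter, Finset.mem_univ, true_and, Fintype.mem_piFinset]
    constructor
    · intro h k
      split_ifs with hk
      · simpa [hk] using h
      · exact Finset.mem_univ _
    · intro h
      simpa using h j
  rw [h1, Fintype.card_piFinset, Fintype.card_pi, ← Finset.mul_prod_erase _ _ (Finset.mem_univ j),
    ← Finset.mul_prod_erase (a := j) _ (fun k => Finset.card (if k = j then _ else _))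
      (Finset.mem_univ j), if_pos rfl, ← mul_assoc]
  refine Nat.mul_le_mul h (le_of_eq (Finset.prod_congr rfl fun k hk => ?_))
  rw [if_neg (Finset.ne_of_mem_erase hk), Finset.card_univ]

theorem card_fiber_mul_le {I B : Type*} [Fintype I] [Fintype B] [DecidableEq B]
    (late : I → Prop) [DecidablePred late] (Q : Finset B) (b : Bool) (z : B → Bool) :
    ({y | decide (late y.1) = b ∧ (fun q => if late y.1 ∧ q ∈ Q then y.2 q else false) = z} :
        Finset (I × (B → Bool))).card * 2 ^ (if b then Q.card else 0) ≤
      ({y | decide (late y.1) = b} : Finset (I × (B → Bool))).card := by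
  cases b with
  | false =>
    simp only [Bool.false_eq_true, if_false, pow_zero, mul_one]
    exact Finset.card_le_card fun y hy => by
      simp only [Finset.mem_filter, Finset.mem_univ, true_and] at hy ⊢
      exact hy.1
  | true =>
    simp only [if_true]
    have h2 : 2 ^ Q.card = (Finset.univ : Finset (Q → Bool)).card := by simp
    rw [h2, ← Finset.card_product]
    refine Finset.card_le_card_of_injOn
      (fun w => (w.1.1, fun q => if h : q ∈ Q then w.2 ⟨q, h⟩ else w.1.2 q)) ?_ ?_
    · intro w hw
      simp only [Finset.coe_product, Set.mem_prod, Finset.mem_coe, Finset.mem_filter,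
        Finset.mem_univ, true_and, and_true] at hw ⊢
      exact hw.1
    · rintro ⟨⟨k, y⟩, u⟩ hw ⟨⟨k', y'⟩, u'⟩ hw' h
      simp only [Finset.coe_product, Set.mem_prod, Finset.mem_coe, Finset.mem_filter,
        Finset.mem_univ, true_and, and_true, decide_eq_true_eq] at hw hw'
      obtain ⟨hk, hu⟩ := Prod.ext_iff.1 h
      simp only at hk hu
      subst hk
      have hy : y = y' := by
        ext q
        by_cases hq : q ∈ Q
        · have h3 := congrFun (hw.2.trans hw'.2.symm) q
          simpa [hw.1, hq] using h3
        · have h3 := congrFun hu q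
          simpa [hq] using h3
      have hu' : u = u' := by
        ext q
        have h3 := congrFun hu q
        simpa using h3
      rw [hy, hu']

theorem mainTheorem8 (n t : ℕ) [NeZero (n * t)] (hn : Odd n) (hn3 : 3 ≤ n) (ht : 2 ≤ t)
    (i : Fin n) (a : Fin (n * t)) (r : ℕ) (hr : r + n ≤ n * t) :
    ((goodParticles n t i (arc a r)).card : ℝ) / 4 ≤
      entanglementEntropy (psiCycle n t i) (arc a r) := by
  classical
  obtain ⟨m, hm⟩ : ∃ m, n = 2 * m + 3 := by
    obtain ⟨l, hl⟩ := hn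
    exact ⟨l - 1, by omega⟩
  let A : Fin t → ℕ → Prop := fun j p => segmentSite n t i j (p + 1) ∈ arc a r
  choose late Q hshared hQ hlate using fun j : Fin t => exists_isSharedLate hm (A j)
    (arc_segment_convex n t i a r hr j)
  let Y := PathIndex m × (Fin ((n - 3) / 2) → Bool)
  let e : Fin t × Fin n ≃ Fin (n * t) := Equiv.ofBijective _ (segmentSite_bijective n t i)
  let F : (Fin t → Y) → Fin (n * t) → SiteState := fun ω k =>
    segConf n m (ω (e.symm k).1) (e.symm k).2
  have hFe : ∀ ω (j : Fin t) (p : Fin n),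
      F ω (segmentSite n t i j (p + 1)) = segConf n m (ω j) p := fun ω j p => by
    have : e.symm (segmentSite n t i j (p + 1)) = (j, p) := e.symm_apply_apply (j, p)
    simp only [F, this]
  have hF : Function.Injective F := fun ω ω' h => by
    ext1 j
    refine segConf_injective hm (funext fun p => ?_)
    rw [← hFe, ← hFe, h]
  have hcardΩ : (Fintype.card (Fin t → Y) : ℝ) = (Fintype.card Y : ℝ) ^ t := by
    rw [Fintype.card_fun, Fintype.card_fin, Nat.cast_pow]
  have hagree : ∀ (P : Fin (n * t) → Prop) ω ω', (∀ k, P k → F ω k = F ω' k) → ∀ (j : Fin t)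
      (p : Fin n), P (segmentSite n t i j (p + 1)) → segConf n m (ω j) p = segConf n m (ω' j) p :=
    fun P ω ω' h j p hp => by rw [← hFe, ← hFe, h _ hp]
  let q : (Fin t → Bool) → ℕ := fun c => ∑ j, if c j then (Q j).card else 0
  have hmain := le_entanglementEntropy_of_uniform F hF (psiCycle n t i) ?_ ?_ (arc a r)
    (fun ω j => decide (late j (ω j).1))
    (fun ω j b => if late j (ω j).1 ∧ b ∈ Q j then (ω j).2 b else false) q ?_ ?_ ?_
  · refine le_trans ?_ hmain
    have hN : (0 : ℝ) < Fintype.card (Fin t → Y) := by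
      exact_mod_cast Fintype.card_pos
    rw [div_le_div_iff₀ (by norm_num) hN]
    have h1 : ∑ ω : Fin t → Y, q (fun j => decide (late j (ω j).1)) =
        ∑ j, ({ω | late j (ω j).1} : Finset (Fin t → Y)).card * (Q j).card := by
      simp only [q]
      rw [Finset.sum_comm]
      refine Finset.sum_congr rfl fun j _ => ?_
      simp only [decide_eq_true_eq]
      rw [← Finset.sum_filter, Finset.sum_const, smul_eq_mul]
    have h2 : ∀ j, Fintype.card (Fin t → Y) ≤
        4 * ({ω | late j (ω j).1} : Finset (Fin t → Y)).card := fun j => by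
      refine card_pi_le_of_card_le (fun y : Y => late j y.1) ?_ j
      have h3 : ({y | late j y.1} : Finset Y) =
          ({k | late j k} : Finset (PathIndex m)) ×ˢ Finset.univ := by
        ext ⟨k, x⟩
        rw [Finset.mem_product, Finset.mem_filter, Finset.mem_filter]
        simp
      rw [h3, Finset.card_product, Fintype.card_prod, ← mul_assoc, Finset.card_univ]
      exact Nat.mul_le_mul_right _ (hlate j)
    have h3 : (goodParticles n t i (arc a r)).card * Fintype.card (Fin t → Y) ≤
        (∑ ω : Fin t → Y, q (fun j => decide (late j (ω j).1))) * 4 := by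
      rw [h1, Finset.sum_mul]
      refine (Nat.mul_le_mul_right _ ((card_goodParticles_le n t i _).trans
        (Finset.sum_le_sum fun j _ => hQ j))).trans ?_
      rw [Finset.sum_mul]
      refine Finset.sum_le_sum fun j _ => ?_
      calc (Q j).card * Fintype.card (Fin t → Y) ≤ _ := Nat.mul_le_mul_left _ (h2 j)
        _ = _ := by ring
    exact_mod_cast h3
  · intro ω
    simp only [psiCycle, hFe, phiGround_segConf hm]
    rw [Finset.prod_const, Finset.card_univ, Fintype.card_fin, hcardΩ, ← Complex.ofReal_pow, inv_pow]
    congr 2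
    rw [eq_comm, Real.sqrt_eq_iff_mul_self_eq (by positivity) (by positivity), ← mul_pow,
      Real.mul_self_sqrt (by positivity)]
  · intro s hs
    have h1 : ∃ j : Fin t, (fun p : Fin n => s (segmentSite n t i j (p + 1))) ∉
        Set.range (segConf n m) := by
      by_contra! h
      choose ω hω using h
      refine hs ⟨ω, funext fun k => ?_⟩
      obtain ⟨⟨j, p⟩, rfl⟩ := e.surjective k
      exact (hFe ω j p).trans (congrFun (hω j) p)
    obtain ⟨j, hj⟩ := h1
    exact Finset.prod_eq_zero (Finset.mem_univ j) (phiGround_eq_zero hm _ hj)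
  · intro ω ω' h
    have h1 : ∀ j, late j (ω j).1 ↔ late j (ω' j).1 := fun j =>
      (hshared j).late_iff _ _ (hagree _ ω ω' h j)
    refine ⟨funext fun j => by simp only [h1], funext fun j => funext fun b => ?_⟩
    by_cases hl : late j (ω j).1 ∧ b ∈ Q j
    · rw [if_pos hl, if_pos ⟨(h1 j).1 hl.1, hl.2⟩]
      exact (hshared j).outside _ _ (hagree _ ω ω' h j) hl.1 ((h1 j).1 hl.1) b hl.2
    · rw [if_neg hl, if_neg fun h' => hl ⟨(h1 j).2 h'.1, h'.2⟩]
  · intro ω ω' hc h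
    have h1 : ∀ j, late j (ω j).1 ↔ late j (ω' j).1 := fun j => by
      simpa using congrFun hc j
    refine funext fun j => funext fun b => ?_
    by_cases hl : late j (ω j).1 ∧ b ∈ Q j
    · rw [if_pos hl, if_pos ⟨(h1 j).1 hl.1, hl.2⟩]
      exact (hshared j).inside _ _ (hagree _ ω ω' h j) hl.1 ((h1 j).1 hl.1) b hl.2
    · rw [if_neg hl, if_neg fun h' => hl ⟨(h1 j).2 h'.1, h'.2⟩]
  · intro c z
    have h1 : ({ω | (fun j => decide (late j (ω j).1)) = c ∧
        (fun j b => if late j (ω j).1 ∧ b ∈ Q j then (ω j).2 b else false) = z} :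
          Finset (Fin t → Y)) =
        Fintype.piFinset fun j => ({y | decide (late j y.1) = c j ∧
          (fun b => if late j y.1 ∧ b ∈ Q j then y.2 b else false) = z j} : Finset Y) := by
      ext ω
      simp only [Finset.mem_filter, Finset.mem_univ, true_and, Fintype.mem_piFinset, funext_iff,
        forall_and]
    have h2 : ({ω | (fun j => decide (late j (ω j).1)) = c} : Finset (Fin t → Y)) =
        Fintype.piFinset fun j => ({y | decide (late j y.1) = c j} : Finset Y) := by
      ext ω
      simp only [Finset.mem_filter, Finset.mem_univ, true_and, Fintype.mem_piFinset, funext_iff]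
    rw [h1, h2, Fintype.card_piFinset, Fintype.card_piFinset, ← Finset.prod_pow_eq_pow_sum,
      ← Finset.prod_mul_distrib]
    exact Finset.prod_le_prod' fun j _ => card_fiber_mul_le (late j) (Q j) (c j) (z j)
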